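/- \textbf{Theorem (Completion Lemma).} First-order formulas are built from $\bot$, atoms (including equalities), $\wedge,\vee,\to,\forall,\exists$; $\neg K$ abbreviates $K\to\bot$. For a finite tuple ${\bf p}=p_1,\dots,p_n$ of predicate constants (equality is not one of them) and a first-order sentence $F$, $\mathrm{SM}_{\bf p}[F]$ is the second-order sentence $$F\wedge\neg\exists{\bf u}\,\bigl(({\bf u}<{\bf p})\wedge F^*({\bf u})\bigr),$$ where ${\bf u}=u_1,\dots,u_n$ are predicate variables, ${\bf u}<{\bf p}$ says that each $u_i$ is contained in $p_i$ and at least one containment is proper, and $F^*({\bf u})$ is obtained recursively: $p_i({\bf t})^*$ is $u_i({\bf t})$; $A^*=A$ for the other atoms and $\bot$; $^*$ commutes with $\wedge,\vee,\forall,\exists$; $(A\to B)^*=(A^*\to B^*)\wedge(A\to B)$. An occurrence of a predicate constant in a formula is positive if the number of implications containing it in the antecedent is even, strictly positive if that number is $0$, and negated if it lies in a subformula of the form $\neg K$ (nonnegated otherwise). An FOL rule of $F$ is a strictly positive occurrence of an implication $A\to B$ in $F$. Let $F$ be a first-order sentence and let ${\bf p}$, ${\bf q}$ be disjoint finite tuples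 of predicate constants, each consisting of distinct members. Suppose that (i) no member of ${\bf q}$ has a strictly positive occurrence in $F$, and for every FOL rule $A\to B$ of $F$ with $B\neq\bot$, no member of ${\bf q}$ has a positive nonnegated occurrence in $A$; (ii) $D$ is a sentence in Clark normal form relative to ${\bf q}$, i.e. $D=\bigwedge_{q\in{\bf q}}\forall\vec x\,(G_q(\vec x)\to q(\vec x))$, with $\vec x$ a tuple of distinct variables and all free variables of $G_q$ among $\vec x$, and no member of ${\bf q}$ has a positive nonnegated occurrence in any $G_q$. Let $\mathrm{Comp}[D]=\bigwedge_{q\in{\bf q}}\forall\vec x\,(G_q(\vec x)\leftrightarrow q(\vec x))$. Then $\mathrm{SM}_{\bf pq}[F\wedge D]$ is equivalent (satisfied by the same interpretations) to each of $$\mathrm{SM}_{\bf pq}[F\wedge D]\wedge \mathrm{Comp}[D],\qquad \mathrm{SM}_{\bf p}[F]\wedge \mathrm{Comp}[D],$$ $$\mathrm{SM}_{\bf pq}\Bigl[F\wedge\bigwedge_{q\in{\bf q}}\forall\vec x\,\bigl(\neg\neg q(\vec x)\to q(\vec x)\bigr)\Bigr]\wedge \mathrm{Comp}[D].$$ -/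

import Mathlib

universe u v w

namespace StableModels

/-- A predicate constant of the signature `L`, with its arity. Equality is not one of them. -/
abbrev Pred (L : FirstOrder.Language.{u, v}) : Type v := Σ k : ℕ, L.Relations k

/-- First-order formulas over `L` whose free variables are among `x_0, …, x_{n-1}`.
The primitives are `⊥, ∧, ∨, →, ∀, ∃` and the atoms; a quantifier binds the last variable. -/
inductive Fml (L : FirstOrder.Language.{u, v}) : ℕ → Type (max u v)
  | falsum {n : ℕ} : Fml L n
  | equal {n : ℕ} (t₁ t₂ : L.Term (Fin n)) : Fml L n
  | rel {n k : ℕ} (R : L.Relations k) (ts : Fin k → L.Term (Fin n)) : Fml L n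
  | and {n : ℕ} (A B : Fml L n) : Fml L n
  | or {n : ℕ} (A B : Fml L n) : Fml L n
  | imp {n : ℕ} (A B : Fml L n) : Fml L n
  | all {n : ℕ} (A : Fml L (n + 1)) : Fml L n
  | ex {n : ℕ} (A : Fml L (n + 1)) : Fml L n

/-- A first-order sentence. -/
abbrev Sent (L : FirstOrder.Language.{u, v}) : Type (max u v) := Fml L 0

/-- `neg A` is `A → ⊥`. -/
def Fml.neg {L : FirstOrder.Language.{u, v}} {n : ℕ} (A : Fml L n) : Fml L n := .imp A .falsum

/-- `⊤` is `⊥ → ⊥`. -/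
def Fml.verum {L : FirstOrder.Language.{u, v}} {n : ℕ} : Fml L n := .imp .falsum .falsum

/-- `A ↔ B` is `(A → B) ∧ (B → A)`. -/
def Fml.iff {L : FirstOrder.Language.{u, v}} {n : ℕ} (A B : Fml L n) : Fml L n :=
  .and (.imp A B) (.imp B A)

/-- Conjunction of a finite list of formulas; the empty conjunction is `⊤`. -/
def Fml.conj {L : FirstOrder.Language.{u, v}} {n : ℕ} : List (Fml L n) → Fml L n
  | [] => .verum
  | [A] => A
  | A :: B :: l => .and A (Fml.conj (B :: l))

/-- `∀ x_0 … ∀ x_{n-1} A`. -/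
def Fml.alls {L : FirstOrder.Language.{u, v}} : {n : ℕ} → Fml L n → Sent L
  | 0, A => A
  | _ + 1, A => Fml.alls (.all A)

/-- The atom `r(x_0, …, x_{k-1})` where `k` is the arity of `r`. -/
def Pred.atom {L : FirstOrder.Language.{u, v}} (r : Pred L) : Fml L r.1 :=
  .rel r.2 (fun i => FirstOrder.Language.Term.var i)

/-- Classical satisfaction of a formula in the interpretation `M` under the assignment `v`. -/
def Fml.Realize {L : FirstOrder.Language.{u, v}} (M : Type w) [L.Structure M] :
    {n : ℕ} → Fml L n → (Fin n → M) → Prop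
  | _, .falsum, _ => False
  | _, .equal t₁ t₂, v => t₁.realize v = t₂.realize v
  | _, .rel R ts, v => FirstOrder.Language.Structure.RelMap R (fun i => (ts i).realize v)
  | _, .and A B, v => A.Realize M v ∧ B.Realize M v
  | _, .or A B, v => A.Realize M v ∨ B.Realize M v
  | _, .imp A B, v => A.Realize M v → B.Realize M v
  | _, .all A, v => ∀ a : M, A.Realize M (Fin.snoc v a)
  | _, .ex A, v => ∃ a : M, A.Realize M (Fin.snoc v a)

/-- The interpretation `M` satisfies the sentence `F`. -/
def Sent.Holds {L : FirstOrder.Language.{u, v}} (M : Type w) [L.Structure M] (F : Sent L) : Prop :=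
  Fml.Realize M F Fin.elim0

/-! ### The operator `SM` -/

/-- The predicate variables `u_r`, one for each member `r` of the tuple `p`, of the same arity. -/
def predVars {L : FirstOrder.Language.{u, v}} (p : List (Pred L)) : FirstOrder.Language.{0, v} :=
  ⟨fun _ => Empty, fun k => {R : L.Relations k // (⟨k, R⟩ : Pred L) ∈ p}⟩

/-- A formula over `L`, read over the signature extended by the predicate variables. -/
def Fml.lift {L : FirstOrder.Language.{u, v}} (p : List (Pred L)) :
    {n : ℕ} → Fml L n → Fml (L.sum (predVars p)) n
  | _, .falsum => .falsum
  | _, .equal t₁ t₂ => .equal (FirstOrder.Language.LHom.sumInl.onTerm t₁) (FirstOrder.Language.LHom.sumInl.onTerm t₂)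
  | _, .rel R ts => .rel (Sum.inl R) (fun i => FirstOrder.Language.LHom.sumInl.onTerm (ts i))
  | _, .and A B => .and (A.lift p) (B.lift p)
  | _, .or A B => .or (A.lift p) (B.lift p)
  | _, .imp A B => .imp (A.lift p) (B.lift p)
  | _, .all A => .all (A.lift p)
  | _, .ex A => .ex (A.lift p)

open Classical in
/-- The formula `F*(u)`, where `u` is the tuple of predicate variables for `p`. -/
noncomputable def Fml.star {L : FirstOrder.Language.{u, v}} (p : List (Pred L)) :
    {n : ℕ} → Fml L n → Fml (L.sum (predVars p)) n
  | _, .falsum => .falsum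
  | _, .equal t₁ t₂ => .equal (FirstOrder.Language.LHom.sumInl.onTerm t₁) (FirstOrder.Language.LHom.sumInl.onTerm t₂)
  | _, .rel (k := k) R ts =>
      if h : (⟨k, R⟩ : Pred L) ∈ p then
        .rel (Sum.inr ⟨R, h⟩) (fun i => FirstOrder.Language.LHom.sumInl.onTerm (ts i))
      else
        .rel (Sum.inl R) (fun i => FirstOrder.Language.LHom.sumInl.onTerm (ts i))
  | _, .and A B => .and (A.star p) (B.star p)
  | _, .or A B => .or (A.star p) (B.star p)
  | _, .imp A B => .and (.imp (A.star p) (B.star p)) (.imp (A.lift p) (B.lift p))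
  | _, .all A => .all (A.star p)
  | _, .ex A => .ex (A.star p)

/-- `u ≤ p`: each predicate variable is contained in its predicate constant. -/
def VarsLe {L : FirstOrder.Language.{u, v}} {M : Type w} [L.Structure M] (p : List (Pred L))
    (U : (predVars p).Structure M) : Prop :=
  ∀ (k : ℕ) (R : L.Relations k) (h : (⟨k, R⟩ : Pred L) ∈ p) (x : Fin k → M),
    U.RelMap (n := k) ⟨R, h⟩ x → FirstOrder.Language.Structure.RelMap R x

/-- `p ≤ u`. -/
def LeVars {L : FirstOrder.Language.{u, v}} {M : Type w} [L.Structure M] (p : List (Pred L))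
    (U : (predVars p).Structure M) : Prop :=
  ∀ (k : ℕ) (R : L.Relations k) (h : (⟨k, R⟩ : Pred L) ∈ p) (x : Fin k → M),
    FirstOrder.Language.Structure.RelMap R x → U.RelMap (n := k) ⟨R, h⟩ x

/-- `F*(u)` holds in `M` when the predicate variables `u` have the values `U`. -/
def StarHolds {L : FirstOrder.Language.{u, v}} (M : Type w) [L.Structure M] (p : List (Pred L))
    (U : (predVars p).Structure M) (F : Sent L) : Prop :=
  letI := U
  Sent.Holds M (F.star p)

/-- The interpretation `M` satisfies the second-order sentence `SM_p[F]`, that is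
`F ∧ ¬∃ u ((u < p) ∧ F*(u))`, where `u < p` is `(u ≤ p) ∧ ¬ (p ≤ u)`. -/
def SM {L : FirstOrder.Language.{u, v}} (M : Type w) [L.Structure M] (p : List (Pred L)) (F : Sent L) :
    Prop :=
  Sent.Holds M F ∧
    ¬ ∃ U : (predVars p).Structure M, (VarsLe p U ∧ ¬ LeVars p U) ∧ StarHolds M p U F

/-! ### Occurrences and rules -/

/-- An occurrence of a predicate constant in a formula: the constant, the number of implications
that contain the occurrence in their antecedent, and whether it lies in a subformula `K → ⊥`. -/
structure Occurrence (L : FirstOrder.Language.{u, v}) where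
  pred : Pred L
  antecedents : ℕ
  negated : Prop

/-- The occurrences of predicate constants in a formula, from left to right. -/
def Fml.occurrences {L : FirstOrder.Language.{u, v}} : {n : ℕ} → Fml L n → List (Occurrence L)
  | _, .falsum => []
  | _, .equal _ _ => []
  | _, .rel (k := k) R _ => [⟨⟨k, R⟩, 0, False⟩]
  | _, .and A B => A.occurrences ++ B.occurrences
  | _, .or A B => A.occurrences ++ B.occurrences
  | _, .imp A B =>
      A.occurrences.map (fun o => ⟨o.pred, o.antecedents + 1, o.negated ∨ B = .falsum⟩)
        ++ B.occurrences
  | _, .all A => A.occurrences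
  | _, .ex A => A.occurrences

def Occurrence.Positive {L : FirstOrder.Language.{u, v}} (o : Occurrence L) : Prop := Even o.antecedents

def Occurrence.StrictlyPositive {L : FirstOrder.Language.{u, v}} (o : Occurrence L) : Prop :=
  o.antecedents = 0

/-- Some member of `q` has a strictly positive occurrence in `A`. -/
def Fml.HasStrictlyPositive {L : FirstOrder.Language.{u, v}} {n : ℕ} (q : List (Pred L)) (A : Fml L n) :
    Prop :=
  ∃ o ∈ A.occurrences, o.pred ∈ q ∧ o.StrictlyPositive

/-- Some member of `q` has a positive nonnegated occurrence in `A`. -/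
def Fml.HasPositiveNonnegated {L : FirstOrder.Language.{u, v}} {n : ℕ} (q : List (Pred L)) (A : Fml L n) :
    Prop :=
  ∃ o ∈ A.occurrences, o.pred ∈ q ∧ o.Positive ∧ ¬ o.negated

/-- An implication `body → head`, possibly with free variables. -/
structure FOLRule (L : FirstOrder.Language.{u, v}) where
  vars : ℕ
  body : Fml L vars
  head : Fml L vars

/-- The FOL rules of a formula: its strictly positive occurrences of implications. -/
def Fml.rules {L : FirstOrder.Language.{u, v}} : {n : ℕ} → Fml L n → List (FOLRule L)
  | _, .falsum => []
  | _, .equal _ _ => []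
  | _, .rel _ _ => []
  | _, .and A B => A.rules ++ B.rules
  | _, .or A B => A.rules ++ B.rules
  | n, .imp A B => ⟨n, A, B⟩ :: B.rules
  | _, .all A => A.rules
  | _, .ex A => A.rules

/-! ### Clark normal form, completion, choice formulas -/

/-- The formula in Clark normal form relative to `q` with definitions `G`: the conjunction of
`∀ x (G_r(x) → r(x))` for `r` in `q`. The values of `G` outside `q` are not used. -/
def clark {L : FirstOrder.Language.{u, v}} (q : List (Pred L)) (G : (r : Pred L) → Fml L r.1) : Sent L :=
  Fml.conj (q.map fun r => (Fml.imp (G r) r.atom).alls)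

/-- The completion of `clark q G`: the conjunction of `∀ x (G_r(x) ↔ r(x))` for `r` in `q`. -/
def completion {L : FirstOrder.Language.{u, v}} (q : List (Pred L)) (G : (r : Pred L) → Fml L r.1) :
    Sent L :=
  Fml.conj (q.map fun r => (Fml.iff (G r) r.atom).alls)

/-- The conjunction of the choice formulas `∀ x (¬¬r(x) → r(x))` for `r` in `q`. -/
def choice {L : FirstOrder.Language.{u, v}} (q : List (Pred L)) : Sent L :=
  Fml.conj (q.map fun r => (Fml.imp r.atom.neg.neg r.atom).alls)

end StableModels

namespace StableModels

open FirstOrder FirstOrder.Language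

/-! ### Here-and-there semantics of `F*` -/

section HereAndThere

variable {L : FirstOrder.Language.{u, v}} {M : Type w} [L.Structure M]

/-! Read `F*(u)` as truth in the "here" world of a here-and-there model whose "there" world is `M`.
A stable model is then one with no smaller "here" world satisfying `F` (`sm_iff`). Completion comes
from testing stability with one competitor: keep everything but shrink each `q` to the extension of
`G_q` in `M`. It satisfies `F*` because `q` is never strictly positive in `F` (`Fml.Realize.here`),
and `D*` because truth here implies truth there. So stability forces `q` to equal `G_q`. Conversely,
let `M` be `p`-stable for `F` and satisfy the completion, and let `U` be a competitor for `F ∧ D`.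
Restoring `q` to its full value preserves `F*` (`Fml.Here.mono`), so stability in `p` makes `U`
standard outside `q`. Then `G_q` passes down from `M` to `U` (`Fml.Here.anti`), and `D*` restores
`q`. The choice formulas merely freeze `q`, reducing `pq`-stability to `p`-stability. -/

/-- An interpretation of all predicate constants of `L` in `M`. -/
abbrev PredFamily (L : FirstOrder.Language.{u, v}) (M : Type w) : Type (max v w) :=
  (r : Pred L) → (Fin r.1 → M) → Prop

variable (L M) in
/-- The interpretation of the predicate constants given by the structure `M`. -/
def PredFamily.standard : PredFamily L M := fun r x => Structure.RelMap r.2 x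

/-- Truth of `A*` when the predicate constants are reinterpreted by `U`: the "here" world of
here-and-there logic, the "there" world being `M`. -/
def Fml.Here (U : PredFamily L M) : {n : ℕ} → Fml L n → (Fin n → M) → Prop
  | _, .falsum, _ => False
  | _, .equal t₁ t₂, v => t₁.realize v = t₂.realize v
  | _, .rel (k := k) R ts, v => U ⟨k, R⟩ (fun i => (ts i).realize v)
  | _, .and A B, v => A.Here U v ∧ B.Here U v
  | _, .or A B, v => A.Here U v ∨ B.Here U v
  | _, .imp A B, v => (A.Here U v → B.Here U v) ∧ (A.Realize M v → B.Realize M v)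
  | _, .all A, v => ∀ a : M, A.Here U (Fin.snoc v a)
  | _, .ex A, v => ∃ a : M, A.Here U (Fin.snoc v a)

/-- `Here` at the standard interpretation is classical satisfaction. -/
theorem Fml.here_standard {n : ℕ} (A : Fml L n) (v : Fin n → M) :
    A.Here (PredFamily.standard L M) v ↔ A.Realize M v := by
  induction A with
  | falsum => rfl
  | equal => rfl
  | rel => rfl
  | and A B hA hB => simp only [Fml.Here, Fml.Realize, hA, hB]
  | or A B hA hB => simp only [Fml.Here, Fml.Realize, hA, hB]
  | imp A B hA hB => simp only [Fml.Here, Fml.Realize, hA, hB, and_self]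
  | all A hA => simp only [Fml.Here, Fml.Realize, hA]
  | ex A hA => simp only [Fml.Here, Fml.Realize, hA]

/-- Truth here implies truth there. -/
theorem Fml.Here.realize {U : PredFamily L M} (hU : U ≤ PredFamily.standard L M) {n : ℕ}
    {A : Fml L n} {v : Fin n → M} (h : A.Here U v) : A.Realize M v := by
  induction A with
  | falsum => exact h
  | equal => exact h
  | rel R ts => exact hU _ _ h
  | and A B hA hB => exact ⟨hA h.1, hB h.2⟩
  | or A B hA hB => exact h.imp hA hB
  | imp A B hA hB => exact h.2
  | all A hA => exact fun a => hA (h a)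
  | ex A hA => exact h.imp fun a => hA

/-- Truth here persists to truth there, so a negation looks only at the "there" world. This is what
lets negated occurrences be ignored. -/
theorem Fml.here_neg {U : PredFamily L M} (hU : U ≤ PredFamily.standard L M) {n : ℕ}
    {A : Fml L n} {v : Fin n → M} : (Fml.imp A .falsum).Here U v ↔ ¬ A.Realize M v :=
  ⟨fun h => h.2, fun h => ⟨fun h' => h (h'.realize hU), h⟩⟩

theorem Fml.here_alls (U : PredFamily L M) {n : ℕ} (A : Fml L n) :
    A.alls.Here U Fin.elim0 ↔ ∀ v, A.Here U v := by
  induction n with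
  | zero => exact ⟨fun h v => Subsingleton.elim Fin.elim0 v ▸ h, fun h => h _⟩
  | succ n ih =>
    refine (ih (.all A)).trans ⟨fun h v => ?_, fun h v a => h _⟩
    have := h (Fin.init v) (v (Fin.last n))
    rwa [Fin.snoc_init_self] at this

theorem Fml.here_conj (U : PredFamily L M) {n : ℕ} (l : List (Fml L n)) (v : Fin n → M) :
    (Fml.conj l).Here U v ↔ ∀ A ∈ l, A.Here U v := by
  induction l with
  | nil => simp [Fml.conj, Fml.verum, Fml.Here]
  | cons A l ih =>
    cases l with
    | nil => simp [Fml.conj]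
    | cons B l =>
      rw [List.forall_mem_cons, ← ih]
      rfl

/-! ### `SM` in terms of interpretations of all predicate constants -/

open Classical in
/-- The family that agrees with the values `U` of the predicate variables for `p`, and with `M`
outside `p`. -/
noncomputable def PredFamily.ofVars (p : List (Pred L)) (U : (predVars p).Structure M) :
    PredFamily L M := fun r x =>
  if h : r ∈ p then U.RelMap (n := r.1) ⟨r.2, h⟩ x else PredFamily.standard L M r x

/-- The values of the predicate variables for `p` given by a family. -/
@[reducible]
def PredFamily.toVars (p : List (Pred L)) (U : PredFamily L M) : (predVars p).Structure M where
  funMap f := nomatch f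
  RelMap R x := U ⟨_, R.1⟩ x

theorem PredFamily.ofVars_toVars {p : List (Pred L)} {U : PredFamily L M}
    (h : ∀ r ∉ p, U r = PredFamily.standard L M r) : ofVars p (U.toVars p) = U := by
  funext r x
  unfold ofVars
  split_ifs with hr
  · rfl
  · rw [h r hr]

theorem Fml.realize_lift (p : List (Pred L)) (U : (predVars p).Structure M) {n : ℕ}
    (A : Fml L n) (v : Fin n → M) : (A.lift p).Realize M v ↔ A.Realize M v := by
  induction A with
  | falsum => rfl
  | equal => simp only [Fml.lift, Fml.Realize, LHom.realize_onTerm]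
  | rel R ts =>
    simp only [Fml.lift, Fml.Realize, LHom.realize_onTerm]
    rfl
  | and A B hA hB => simp only [Fml.lift, Fml.Realize, hA, hB]
  | or A B hA hB => simp only [Fml.lift, Fml.Realize, hA, hB]
  | imp A B hA hB => simp only [Fml.lift, Fml.Realize, hA, hB]
  | all A hA => simp only [Fml.lift, Fml.Realize, hA]
  | ex A hA => simp only [Fml.lift, Fml.Realize, hA]

theorem Fml.realize_star (p : List (Pred L)) (U : (predVars p).Structure M) {n : ℕ}
    (A : Fml L n) (v : Fin n → M) :
    (A.star p).Realize M v ↔ A.Here (PredFamily.ofVars p U) v := by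
  induction A with
  | falsum => rfl
  | equal => simp only [Fml.star, Fml.Here, Fml.Realize, LHom.realize_onTerm]
  | rel R ts =>
    simp only [Fml.star, Fml.Here, PredFamily.ofVars]
    split_ifs <;> simp only [Fml.Realize, LHom.realize_onTerm] <;> rfl
  | and A B hA hB => simp only [Fml.star, Fml.Here, Fml.Realize, hA, hB]
  | or A B hA hB => simp only [Fml.star, Fml.Here, Fml.Realize, hA, hB]
  | imp A B hA hB => simp only [Fml.star, Fml.Here, Fml.Realize, hA, hB, Fml.realize_lift]
  | all A hA => simp only [Fml.star, Fml.Here, Fml.Realize, hA]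
  | ex A hA => simp only [Fml.star, Fml.Here, Fml.Realize, hA]

theorem varsLe_iff {p : List (Pred L)} {U : (predVars p).Structure M} :
    VarsLe p U ↔ PredFamily.ofVars p U ≤ PredFamily.standard L M := by
  constructor
  · intro h r x hx
    unfold PredFamily.ofVars at hx
    split_ifs at hx with hr
    · exact h _ _ hr x hx
    · exact hx
  · intro h k R hR x hx
    refine h ⟨k, R⟩ x ?_
    rwa [PredFamily.ofVars, dif_pos hR]

theorem leVars_iff {p : List (Pred L)} {U : (predVars p).Structure M} :
    LeVars p U ↔ PredFamily.standard L M ≤ PredFamily.ofVars p U := by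
  constructor
  · intro h r x hx
    unfold PredFamily.ofVars
    split_ifs with hr
    · exact h _ _ hr x hx
    · exact hx
  · intro h k R hR x hx
    have := h ⟨k, R⟩ x hx
    rwa [PredFamily.ofVars, dif_pos hR] at this

/-- `M` is a stable model of `F` iff it satisfies `F` and no family other than the standard one
that lies below it and agrees with it outside `p` satisfies `F*`. -/
theorem sm_iff {p : List (Pred L)} {F : Sent L} :
    SM M p F ↔ F.Realize M Fin.elim0 ∧ ∀ U : PredFamily L M, U ≤ PredFamily.standard L M →
      (∀ r ∉ p, U r = PredFamily.standard L M r) → F.Here U Fin.elim0 →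
        U = PredFamily.standard L M := by
  refine and_congr Iff.rfl ⟨fun h U hU hp hF => ?_, ?_⟩
  · rw [← PredFamily.ofVars_toVars hp] at hU hF ⊢
    refine le_antisymm hU (by_contra fun hn => h ⟨U.toVars p, ⟨varsLe_iff.2 hU, ?_⟩, ?_⟩)
    · rwa [leVars_iff]
    · exact (Fml.realize_star p _ F _).2 hF
  · rintro h ⟨U, ⟨hle, hlt⟩, hF⟩
    refine hlt (leVars_iff.2 (h _ (varsLe_iff.1 hle) (fun r hr => ?_)
      ((Fml.realize_star p U F _).1 hF)).ge)
    funext x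
    rw [PredFamily.ofVars, dif_neg hr]

/-! ### Dependence on the interpretation of `q` -/

/-- Some member of `q` has a nonnegated occurrence in `A` that is not positive. -/
def Fml.HasNegativeNonnegated {n : ℕ} (q : List (Pred L)) (A : Fml L n) : Prop :=
  ∃ o ∈ A.occurrences, o.pred ∈ q ∧ ¬ o.Positive ∧ ¬ o.negated

/-- Entering an antecedent adds one to the count, flipping parity, and adds negation only when the
consequent is `⊥`. -/
theorem Fml.occurrences_of_mem_imp_left {n : ℕ} {A B : Fml L n} (hB : B ≠ .falsum)
    {o : Occurrence L} (ho : o ∈ A.occurrences) (hn : ¬ o.negated) :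
    ∃ o' ∈ (Fml.imp A B).occurrences,
      o'.pred = o.pred ∧ (o'.Positive ↔ ¬ o.Positive) ∧ ¬ o'.negated := by
  refine ⟨⟨o.pred, o.antecedents + 1, o.negated ∨ B = .falsum⟩,
    List.mem_append_left _ (List.mem_map_of_mem ho), rfl, Nat.even_add_one, ?_⟩
  exact not_or.2 ⟨hn, hB⟩

/-- If `U` lies below `V` and they differ only on `q`, then `A*` passes from `V` to `U` when `q`
has no positive nonnegated occurrence in `A`, and from `U` to `V` when it has no negative one. -/
theorem Fml.here_mono_aux {q : List (Pred L)} {U V : PredFamily L M}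
    (hV : V ≤ PredFamily.standard L M) (hUV : U ≤ V) (hq : ∀ r ∉ q, U r = V r) {n : ℕ}
    (A : Fml L n) (v : Fin n → M) :
    (¬ A.HasPositiveNonnegated q → A.Here V v → A.Here U v) ∧
      (¬ A.HasNegativeNonnegated q → A.Here U v → A.Here V v) := by
  have sub : ∀ {m k : ℕ} {A : Fml L m} {B : Fml L k}, A.occurrences ⊆ B.occurrences →
      (¬ B.HasPositiveNonnegated q → ¬ A.HasPositiveNonnegated q) ∧
        (¬ B.HasNegativeNonnegated q → ¬ A.HasNegativeNonnegated q) :=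
    fun h => ⟨mt fun ⟨o, ho, h'⟩ => ⟨o, h ho, h'⟩, mt fun ⟨o, ho, h'⟩ => ⟨o, h ho, h'⟩⟩
  induction A with
  | falsum => exact ⟨fun _ => id, fun _ => id⟩
  | equal => exact ⟨fun _ => id, fun _ => id⟩
  | @rel n k R ts =>
    refine ⟨fun h hR => ?_, fun _ => hUV _ _⟩
    have : (⟨k, R⟩ : Pred L) ∉ q := fun hR =>
      h ⟨⟨⟨k, R⟩, 0, False⟩, List.mem_singleton_self _, hR, Even.zero, id⟩
    simpa only [Fml.Here, hq _ this] using hR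
  | and A B hA hB =>
    have sA := sub (A := A) (B := A.and B) (List.subset_append_left _ _)
    have sB := sub (A := B) (B := A.and B) (List.subset_append_right _ _)
    exact ⟨fun h => And.imp ((hA v).1 (sA.1 h)) ((hB v).1 (sB.1 h)),
      fun h => And.imp ((hA v).2 (sA.2 h)) ((hB v).2 (sB.2 h))⟩
  | or A B hA hB =>
    have sA := sub (A := A) (B := A.or B) (List.subset_append_left _ _)
    have sB := sub (A := B) (B := A.or B) (List.subset_append_right _ _)
    exact ⟨fun h => Or.imp ((hA v).1 (sA.1 h)) ((hB v).1 (sB.1 h)),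
      fun h => Or.imp ((hA v).2 (sA.2 h)) ((hB v).2 (sB.2 h))⟩
  | imp A B hA hB =>
    -- With consequent `⊥` all occurrences are negated and the formula is insensitive to `U` and
    -- `V`; otherwise the two halves of the claim swap on the antecedent.
    by_cases hf : B = .falsum
    · subst hf
      rw [Fml.here_neg hV, Fml.here_neg (hUV.trans hV)]
      exact ⟨fun _ => id, fun _ => id⟩
    have sB := sub (A := B) (B := A.imp B) (List.subset_append_right _ _)
    refine ⟨fun h hi => ⟨fun hAU => (hB v).1 (sB.1 h) (hi.1 ((hA v).2 ?_ hAU)), hi.2⟩,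
      fun h hi => ⟨fun hAV => (hB v).2 (sB.2 h) (hi.1 ((hA v).1 ?_ hAV)), hi.2⟩⟩
    · rintro ⟨o, ho, hoq, hp, hn⟩
      obtain ⟨o', ho', he, hpos, hn'⟩ := Fml.occurrences_of_mem_imp_left hf ho hn
      exact h ⟨o', ho', he ▸ hoq, hpos.2 hp, hn'⟩
    · rintro ⟨o, ho, hoq, hp, hn⟩
      obtain ⟨o', ho', he, hpos, hn'⟩ := Fml.occurrences_of_mem_imp_left hf ho hn
      exact h ⟨o', ho', he ▸ hoq, fun h' => hpos.1 h' hp, hn'⟩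
  | all A hA => exact ⟨fun h hi a => (hA _).1 h (hi a), fun h hi a => (hA _).2 h (hi a)⟩
  | ex A hA =>
    exact ⟨fun h => Exists.imp fun a => (hA _).1 h, fun h => Exists.imp fun a => (hA _).2 h⟩

theorem Fml.Here.anti {q : List (Pred L)} {U V : PredFamily L M}
    (hV : V ≤ PredFamily.standard L M) (hUV : U ≤ V) (hq : ∀ r ∉ q, U r = V r) {n : ℕ}
    {A : Fml L n} {v : Fin n → M} (hA : ¬ A.HasPositiveNonnegated q) (h : A.Here V v) :
    A.Here U v :=
  (Fml.here_mono_aux hV hUV hq A v).1 hA h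

theorem Fml.not_hasStrictlyPositive_mono {q : List (Pred L)} {m n : ℕ} {A : Fml L m}
    {B : Fml L n} (h : A.occurrences ⊆ B.occurrences) (hB : ¬ B.HasStrictlyPositive q) :
    ¬ A.HasStrictlyPositive q :=
  mt (fun ⟨o, ho, h'⟩ => ⟨o, h ho, h'⟩) hB

theorem Fml.not_mem_of_not_hasStrictlyPositive {q : List (Pred L)} {n k : ℕ}
    {R : L.Relations k} {ts : Fin k → L.Term (Fin n)}
    (h : ¬ (Fml.rel R ts).HasStrictlyPositive q) : (⟨k, R⟩ : Pred L) ∉ q := fun hR =>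
  h ⟨⟨⟨k, R⟩, 0, False⟩, List.mem_singleton_self _, hR, rfl⟩

/-- If `q` has no strictly positive occurrence in `A` then shrinking `q` alone turns
satisfaction of `A` into satisfaction of `A*`. -/
theorem Fml.Realize.here {q : List (Pred L)} {U : PredFamily L M}
    (hU : U ≤ PredFamily.standard L M) (hq : ∀ r ∉ q, U r = PredFamily.standard L M r) {n : ℕ}
    {A : Fml L n} {v : Fin n → M} (hA : ¬ A.HasStrictlyPositive q) (h : A.Realize M v) :
    A.Here U v := by
  induction A with
  | falsum => exact h
  | equal => exact h
  | rel R ts =>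
    rw [Fml.Here, hq _ (Fml.not_mem_of_not_hasStrictlyPositive hA)]
    exact h
  | and A B ihA ihB =>
    exact h.imp (ihA (Fml.not_hasStrictlyPositive_mono (List.subset_append_left _ _) hA))
      (ihB (Fml.not_hasStrictlyPositive_mono (List.subset_append_right _ _) hA))
  | or A B ihA ihB =>
    exact h.imp (ihA (Fml.not_hasStrictlyPositive_mono (List.subset_append_left _ _) hA))
      (ihB (Fml.not_hasStrictlyPositive_mono (List.subset_append_right _ _) hA))
  | imp A B ihA ihB =>
    -- The antecedent needs only persistence from here to there, so its occurrences of `q` are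
    -- unrestricted.
    exact ⟨fun hAU => ihB (Fml.not_hasStrictlyPositive_mono (List.subset_append_right _ _) hA)
      (h (hAU.realize hU)), h⟩
  | all A ih => exact fun a => ih hA (h a)
  | ex A ih => exact h.imp fun a => ih hA

/-- If `q` has no strictly positive occurrence in `A`, and no positive nonnegated occurrence in
the bodies of its rules with heads other than `⊥`, then `A*` is preserved when `q` grows. -/
theorem Fml.Here.mono {q : List (Pred L)} {U V : PredFamily L M}
    (hV : V ≤ PredFamily.standard L M) (hUV : U ≤ V) (hq : ∀ r ∉ q, U r = V r) {n : ℕ}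
    {A : Fml L n} {v : Fin n → M} (hA : ¬ A.HasStrictlyPositive q)
    (hr : ∀ ρ ∈ A.rules, ρ.head ≠ .falsum → ¬ ρ.body.HasPositiveNonnegated q)
    (h : A.Here U v) : A.Here V v := by
  induction A with
  | falsum => exact h
  | equal => exact h
  | rel R ts => exact hUV _ _ h
  | and A B ihA ihB =>
    exact h.imp
      (ihA (Fml.not_hasStrictlyPositive_mono (List.subset_append_left _ _) hA)
        fun ρ hρ => hr ρ (List.mem_append_left _ hρ))
      (ihB (Fml.not_hasStrictlyPositive_mono (List.subset_append_right _ _) hA)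
        fun ρ hρ => hr ρ (List.mem_append_right _ hρ))
  | or A B ihA ihB =>
    exact h.imp
      (ihA (Fml.not_hasStrictlyPositive_mono (List.subset_append_left _ _) hA)
        fun ρ hρ => hr ρ (List.mem_append_left _ hρ))
      (ihB (Fml.not_hasStrictlyPositive_mono (List.subset_append_right _ _) hA)
        fun ρ hρ => hr ρ (List.mem_append_right _ hρ))
  | imp A B ihA ihB =>
    by_cases hf : B = .falsum
    · subst hf
      exact (Fml.here_neg hV).2 h.2
    · refine ⟨fun hAV => ?_, h.2⟩
      refine ihB (Fml.not_hasStrictlyPositive_mono (List.subset_append_right _ _) hA)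
        (fun ρ hρ => hr ρ (List.mem_cons_of_mem _ hρ)) (h.1 ?_)
      -- The rule body is antitone in `q`, so it descends from `V` to `U`, where the rule can fire.
      exact hAV.anti hV hUV hq (hr ⟨_, A, B⟩ List.mem_cons_self hf)
  | all A ih => exact fun a => ih hA hr (h a)
  | ex A ih => exact h.imp fun a => ih hA hr

/-! ### Clark normal form, completion, choice -/

theorem here_clark {q : List (Pred L)} {G : (r : Pred L) → Fml L r.1} {U : PredFamily L M} :
    (clark q G).Here U Fin.elim0 ↔ ∀ r ∈ q, ∀ x : Fin r.1 → M,
      ((G r).Here U x → U r x) ∧ ((G r).Realize M x → PredFamily.standard L M r x) := by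
  simp only [clark, Fml.here_conj, List.forall_mem_map, Fml.here_alls]
  rfl

theorem realize_clark {q : List (Pred L)} {G : (r : Pred L) → Fml L r.1} :
    (clark q G).Realize M Fin.elim0 ↔ ∀ r ∈ q, ∀ x : Fin r.1 → M,
      (G r).Realize M x → PredFamily.standard L M r x := by
  simp only [← Fml.here_standard, here_clark, and_self]

theorem holds_completion {q : List (Pred L)} {G : (r : Pred L) → Fml L r.1} :
    Sent.Holds M (completion q G) ↔ ∀ r ∈ q, ∀ x : Fin r.1 → M,
      (G r).Realize M x ↔ PredFamily.standard L M r x := by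
  simp only [Sent.Holds, ← Fml.here_standard, completion, Fml.here_conj, List.forall_mem_map,
    Fml.here_alls]
  refine forall₂_congr fun r _ => forall_congr' fun x => (Fml.here_standard _ x).trans ?_
  rw [Fml.here_standard]
  exact ⟨fun h => ⟨h.1, h.2⟩, fun h => ⟨h.1, h.2⟩⟩

/-- The double negation is evaluated there, so the choice formula says that `q` is contained in its
"here" value; with `U` below the standard family, this pins `U` on `q`. -/
theorem here_choice {q : List (Pred L)} {U : PredFamily L M}
    (hU : U ≤ PredFamily.standard L M) :
    (choice q).Here U Fin.elim0 ↔ ∀ r ∈ q, U r = PredFamily.standard L M r := by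
  simp only [choice, Fml.here_conj, List.forall_mem_map, Fml.here_alls]
  refine forall₂_congr fun r _ => ?_
  have key : ∀ x, (Fml.imp r.atom.neg.neg r.atom).Here U x ↔
      (PredFamily.standard L M r x → U r x) := fun x =>
    ⟨fun h hx => h.1 ((Fml.here_neg hU).2 fun hn => hn hx),
      fun h => ⟨fun hn => h (not_not.1 ((Fml.here_neg hU).1 hn)), not_not.1⟩⟩
  simp only [key]
  exact ⟨fun h => le_antisymm (hU r) h, fun h x => by rw [h]; exact id⟩

theorem realize_choice (q : List (Pred L)) : (choice q).Realize M Fin.elim0 :=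
  (Fml.here_standard _ _).1 ((here_choice le_rfl).2 fun _ _ => rfl)

/-! ### The equivalences for completion and choice -/

theorem SM.holds_completion {F : Sent L} {p q : List (Pred L)} {G : (r : Pred L) → Fml L r.1}
    (hF : ¬ F.HasStrictlyPositive q) (h : SM M (p ++ q) (F.and (clark q G))) :
    Sent.Holds M (completion q G) := by
  classical
  obtain ⟨⟨hFM, hDM⟩, hmin⟩ := sm_iff.1 h
  rw [realize_clark] at hDM
  -- The competitor: each `q` is cut down to what its definition supports in `M`.
  let U : PredFamily L M := fun r x =>
    if r ∈ q then (G r).Realize M x else PredFamily.standard L M r x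
  have hin : ∀ r ∈ q, U r = (G r).Realize M := fun r hr => funext fun x => if_pos hr
  have hout : ∀ r ∉ q, U r = PredFamily.standard L M r := fun r hr => funext fun x => if_neg hr
  have hU : U ≤ PredFamily.standard L M := fun r => by
    by_cases hr : r ∈ q
    · rw [hin r hr]
      exact hDM r hr
    · exact (hout r hr).le
  have hstd := hmin U hU (fun r hr => hout r (mt (List.mem_append_right p) hr))
    ⟨Fml.Realize.here hU hout hF hFM, here_clark.2 fun r hr x =>
      ⟨fun hG => by rw [hin r hr]; exact hG.realize hU, hDM r hr x⟩⟩
  refine StableModels.holds_completion.2 fun r hr x => ?_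
  rw [← hstd, hin r hr]

theorem sm_clark_iff {F : Sent L} {p q : List (Pred L)} {G : (r : Pred L) → Fml L r.1}
    (hF : ¬ F.HasStrictlyPositive q)
    (hr : ∀ ρ ∈ F.rules, ρ.head ≠ .falsum → ¬ ρ.body.HasPositiveNonnegated q)
    (hD : ∀ r ∈ q, ¬ (G r).HasPositiveNonnegated q)
    (hpq : List.Disjoint p q) :
    SM M (p ++ q) (F.and (clark q G)) ↔ SM M p F ∧ Sent.Holds M (completion q G) := by
  classical
  refine ⟨fun h => ⟨?_, h.holds_completion hF⟩, fun ⟨h, hC⟩ => ?_⟩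
  · obtain ⟨⟨hFM, hDM⟩, hmin⟩ := sm_iff.1 h
    rw [realize_clark] at hDM
    refine sm_iff.2 ⟨hFM, fun U hU hp hFU => hmin U hU
      (fun r hr => hp r (mt (List.mem_append_left q) hr)) ⟨hFU, here_clark.2 fun r hr x =>
        ⟨fun hG => ?_, hDM r hr x⟩⟩⟩
    -- A competitor in `p` alone leaves `q` intact, so `D*` follows from `D` by persistence.
    rw [hp r (hpq.symm hr)]
    exact hDM r hr x (hG.realize hU)
  · obtain ⟨hFM, hmin⟩ := sm_iff.1 h
    rw [holds_completion] at hC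
    refine sm_iff.2 ⟨⟨hFM, realize_clark.2 fun r hr x => (hC r hr x).1⟩, fun U hU hp hFU => ?_⟩
    -- Undoing the shrinking of `q` leaves a competitor that differs from `M` at most on `p`.
    let V : PredFamily L M := fun r => if r ∈ q then PredFamily.standard L M r else U r
    have hin : ∀ r ∈ q, V r = PredFamily.standard L M r := fun r hr => if_pos hr
    have hout : ∀ r ∉ q, V r = U r := fun r hr => if_neg hr
    have hV : V ≤ PredFamily.standard L M := fun r => by
      by_cases hr : r ∈ q
      · exact (hin r hr).le
      · exact (hout r hr).le.trans (hU r)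
    have hUV : U ≤ V := fun r => by
      by_cases hr : r ∈ q
      · exact (hU r).trans (hin r hr).ge
      · exact (hout r hr).ge
    have hstd : V = PredFamily.standard L M := by
      refine hmin V hV (fun r hrp => ?_)
        (hFU.1.mono hV hUV (fun r hr => (hout r hr).symm) hF hr)
      by_cases hr : r ∈ q
      · exact hin r hr
      · rw [hout r hr, hp r fun h => (List.mem_append.1 h).elim hrp hr]
    rw [hstd] at hUV hout
    refine le_antisymm hU fun r x hx => ?_
    by_cases hr : r ∈ q
    · refine (here_clark.1 hFU.2 r hr x).1 (Fml.Here.anti le_rfl hU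
        (fun r hr => (hout r hr).symm) (hD r hr) ?_)
      exact (Fml.here_standard _ _).2 ((hC r hr x).2 hx)
    · rwa [← hout r hr]

/-- Under the choice formulas the competitors over `p ++ q` are exactly those over `p`. -/
theorem sm_choice_iff {F : Sent L} {p q : List (Pred L)} (hpq : List.Disjoint p q) :
    SM M (p ++ q) (F.and (choice q)) ↔ SM M p F := by
  rw [sm_iff, sm_iff]
  constructor
  · rintro ⟨⟨hFM, -⟩, hmin⟩
    exact ⟨hFM, fun U hU hp hFU => hmin U hU (fun r hr => hp r (mt (List.mem_append_left q) hr))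
      ⟨hFU, (here_choice hU).2 fun r hr => hp r (hpq.symm hr)⟩⟩
  · rintro ⟨hFM, hmin⟩
    refine ⟨⟨hFM, realize_choice q⟩, fun U hU hp hFU => hmin U hU (fun r hrp => ?_) hFU.1⟩
    by_cases hr : r ∈ q
    · exact (here_choice hU).1 hFU.2 r hr
    · exact hp r fun h => (List.mem_append.1 h).elim hrp hr

end HereAndThere

end StableModels

theorem mainTheorem2 {L : FirstOrder.Language.{u, v}}
    (F : StableModels.Sent L) (p q : List (StableModels.Pred L))
    (G : (r : StableModels.Pred L) → StableModels.Fml L r.1)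
    (hpq : List.Disjoint p q)
    (hF : ¬ F.HasStrictlyPositive q)
    (hFrules : ∀ ρ ∈ F.rules, ρ.head ≠ StableModels.Fml.falsum →
      ¬ ρ.body.HasPositiveNonnegated q)
    (hD : ∀ r ∈ q, ¬ (G r).HasPositiveNonnegated q)
    (M : Type w) [L.Structure M] [Nonempty M] :
    (StableModels.SM M (p ++ q) (F.and (StableModels.clark q G)) ↔
      StableModels.SM M (p ++ q) (F.and (StableModels.clark q G)) ∧
        StableModels.Sent.Holds M (StableModels.completion q G)) ∧
    (StableModels.SM M (p ++ q) (F.and (StableModels.clark q G)) ↔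
      StableModels.SM M p F ∧ StableModels.Sent.Holds M (StableModels.completion q G)) ∧
    (StableModels.SM M (p ++ q) (F.and (StableModels.clark q G)) ↔
      StableModels.SM M (p ++ q) (F.and (StableModels.choice q)) ∧
        StableModels.Sent.Holds M (StableModels.completion q G)) := by
  have h := StableModels.sm_clark_iff (M := M) hF hFrules hD hpq
  refine ⟨⟨fun hs => ⟨hs, hs.holds_completion hF⟩, And.left⟩, h, ?_⟩
  rw [h, StableModels.sm_choice_iff hpq]
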